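/- Let $n\ge 1$ and let $(M,D)$ be a contact manifold of dimension $2n+1$: $M$ is a smooth manifold and $D\subset TM$ is, near each point, the kernel of a contact form $\theta$, i.e. of a nowhere vanishing smooth $1$-form such that $d\theta$ is non-degenerate on $D$. Let $(E_1,E_2)$ be a Lagrangian pair, i.e. $E_1,E_2\subset D$ are smooth subbundles of rank $n$ on which $d\theta$ vanishes for every local contact form $\theta$ for $D$, and $D=E_1\oplus E_2$. A smooth $n$-form $\omega$ on $M$ is called bi-decomposable for $(E_1,E_2)$ if, near each point of $M$, $\omega=\omega_1-\omega_2$ with smooth $n$-forms $\omega_1,\omega_2$ such that $i_u\omega_1=0$ for $u\in E_2$, $i_v\omega_2=0$ for $v\in E_1$, $\omega_1|_{E_1}$ is a volume form on $E_1$, and $\omega_2|_{E_2}$ is a volume form on $E_2$. The Monge–Ampère system $\langle\theta,d\theta,\omega\rangle$ is the sheaf of ideals, in the sheaf of smooth differential forms on $M$, that is locally generated (algebraically) by $\theta$, $d\theta$ and $\omega$, where $\theta$ is a local contact form for $D$. **Theorem.** Let $\omega$ and $\omega'$ be two bi-decomposable $n$-forms for the same Lagrangian pair $(E_1,E_2)$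 on $(M,D)$ which generate the same Monge–Ampère system, $$\langle\theta,d\theta,\omega\rangle=\langle\theta,d\theta,\omega'\rangle .$$ Then, for every contact form $\theta$ for $D$ on an open set $U\subset M$ and every point $x\in U$, there are an open neighbourhood $V\subset U$ of $x$, a nowhere vanishing smooth function $\mu$ on $V$ and a smooth $(n-1)$-form $\eta$ on $V$ such that $$\omega'=\mu\,\omega+\theta\wedge\eta\quad\text{on } V .$$ -/

import Mathlib

open Set
open scoped Manifold ContDiff Topology

noncomputable section

namespace LagrangianContact

/-! ### The exterior product of alternating forms -/

section Wedge

variable {E : Type*} [AddCommGroup E] [Module ℝ E] [TopologicalSpace E]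

/-- The exterior product `a ∧ b` of a `k`-form and an `l`-form, regarded as an `m`-form, where
`k + l = m`: the sum over the `(k, l)`-shuffles `σ` of
`sign σ * a (v (σ 1), …, v (σ k)) * b (v (σ (k + 1)), …, v (σ (k + l)))`. -/
def wedge {k l m : ℕ} (h : k + l = m) (a : E [⋀^Fin k]→L[ℝ] ℝ) (b : E [⋀^Fin l]→L[ℝ] ℝ) :
    E [⋀^Fin m]→L[ℝ] ℝ :=
  { ((LinearMap.mul' ℝ ℝ).compAlternatingMap
      (a.toAlternatingMap.domCoprod b.toAlternatingMap)).domDomCongr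
      (finSumFinEquiv.trans (finCongr h)) with
    cont := by
      change Continuous fun v : Fin m → E =>
        (LinearMap.mul' ℝ ℝ) ((a.toAlternatingMap.domCoprod b.toAlternatingMap)
          (fun i => v ((finSumFinEquiv.trans (finCongr h)) i)))
      simp only [AlternatingMap.domCoprod_apply, _root_.sum_apply, map_sum]
      refine continuous_finsetSum _ fun σ _ => ?_
      induction σ using Quotient.inductionOn' with
      | h σ =>
        simp only [AlternatingMap.domCoprod.summand_mk'', _root_.smul_apply,
          MultilinearMap.domDomCongr_apply, MultilinearMap.domCoprod_apply,
          map_zsmul_unit, LinearMap.mul'_apply]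
        refine Continuous.const_smul (Continuous.mul ?_ ?_) _
        · exact a.cont.comp (by fun_prop)
        · exact b.cont.comp (by fun_prop) }

end Wedge

/-! ### Differential forms and vector fields on a manifold of dimension `d` -/

section Forms

variable {d : ℕ} {M : Type*} [TopologicalSpace M] [ChartedSpace (EuclideanSpace ℝ (Fin d)) M]

variable (d M) in
/-- A (not necessarily smooth) differential `k`-form on `M`. A form on an open subset `U` is
represented by a form on `M` of which only the values at the points of `U` are used. -/
abbrev DiffForm (k : ℕ) : Type _ :=
  (x : M) → TangentSpace (𝓡 d) x [⋀^Fin k]→L[ℝ] ℝ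

/-- The form `α` is smooth on the set `U`, as a section of the bundle of alternating forms. -/
def SmoothFormOn [IsManifold (𝓡 d) ∞ M] {k : ℕ} (α : DiffForm d M k) (U : Set M) : Prop :=
  haveI : IsManifold (𝓡 d) 1 M := IsManifold.of_le (n := ∞) (by simp)
  ContMDiffOn (𝓡 d)
    ((𝓡 d).prod 𝓘(ℝ, EuclideanSpace ℝ (Fin d) [⋀^Fin k]→L[ℝ] ℝ)) ∞
    (fun x => (⟨x, α x⟩ : Bundle.TotalSpace (EuclideanSpace ℝ (Fin d) [⋀^Fin k]→L[ℝ] ℝ)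
      (fun x : M => TangentSpace (𝓡 d) x [⋀^Fin k]→L[ℝ] Bundle.Trivial M ℝ x))) U

/-- The vector field `X` is smooth on the set `U`, as a section of the tangent bundle. -/
def SmoothFieldOn [IsManifold (𝓡 d) ∞ M] (X : (x : M) → TangentSpace (𝓡 d) x) (U : Set M) :
    Prop :=
  haveI : IsManifold (𝓡 d) 1 M := IsManifold.of_le (n := ∞) (by simp)
  ContMDiffOn (𝓡 d) (𝓡 d).tangent ∞ (fun x => (⟨x, X x⟩ : TangentBundle (𝓡 d) M)) U

/-- The exterior derivative of a differential form. Its value at `x` is computed in the chart `φ`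
at `x`: pull `α` back to the model space along `φ⁻¹`, take the exterior derivative there at `φ x`,
and pull the result back along `φ`. -/
def extDer {k : ℕ} (α : DiffForm d M k) : DiffForm d M (k + 1) := fun x =>
  (extDeriv
    (fun y : EuclideanSpace ℝ (Fin d) =>
      (α ((extChartAt (𝓡 d) x).symm y)).compContinuousLinearMap
        (mfderiv 𝓘(ℝ, EuclideanSpace ℝ (Fin d)) (𝓡 d) (extChartAt (𝓡 d) x).symm y))
    (extChartAt (𝓡 d) x x)).compContinuousLinearMap
    (mfderiv (𝓡 d) 𝓘(ℝ, EuclideanSpace ℝ (Fin d)) (extChartAt (𝓡 d) x) x)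

/-- On `U`, the `k`-form `α` is a multiple `β ∧ a` of the `p`-form `β`, with a smooth
coefficient form `a` on `U`. (If `k < p`, only the zero form is a multiple of `β`.) -/
def IsMultipleOn [IsManifold (𝓡 d) ∞ M] (U : Set M) {p k : ℕ} (β : DiffForm d M p)
    (α : DiffForm d M k) : Prop :=
  (∃ (l : ℕ) (h : p + l = k) (a : DiffForm d M l), SmoothFormOn a U ∧
    ∀ x ∈ U, α x = wedge h (β x) (a x)) ∨
  ∀ x ∈ U, α x = 0

/-- The part of degree `k` of the ideal `⟨θ, dθ, w⟩` generated algebraically by `θ`, `dθ` and `w`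
in the graded algebra of smooth differential forms on `U`. -/
def generatedIdeal [IsManifold (𝓡 d) ∞ M] {p : ℕ} (θ : DiffForm d M 1) (w : DiffForm d M p)
    (U : Set M) (k : ℕ) : Set (DiffForm d M k) :=
  {α | ∃ α₁ α₂ α₃ : DiffForm d M k,
    IsMultipleOn U θ α₁ ∧ IsMultipleOn U (extDer θ) α₂ ∧ IsMultipleOn U w α₃ ∧
    ∀ x ∈ U, α x = α₁ x + α₂ x + α₃ x}

end Forms

/-! ### Contact manifolds, Lagrangian pairs and Monge–Ampère systems -/

section Contact

variable {n : ℕ} {M : Type*} [TopologicalSpace M]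
  [ChartedSpace (EuclideanSpace ℝ (Fin (2 * n + 1))) M] [IsManifold (𝓡 (2 * n + 1)) ∞ M]

variable (n M) in
/-- A field of linear subspaces of the tangent spaces of `M`. -/
abbrev Distribution : Type _ := (x : M) → Submodule ℝ (TangentSpace (𝓡 (2 * n + 1)) x)

/-- `θ` is a contact form for `D` on the open set `U`: a smooth nowhere vanishing one-form with
kernel `D` whose exterior derivative is non-degenerate on `D`. -/
structure IsContactFormOn (D : Distribution n M) (θ : DiffForm (2 * n + 1) M 1) (U : Set M) :
    Prop where
  isOpen : IsOpen U
  smooth : SmoothFormOn θ U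
  ne_zero : ∀ x ∈ U, θ x ≠ 0
  mem_iff : ∀ x ∈ U, ∀ v : TangentSpace (𝓡 (2 * n + 1)) x, v ∈ D x ↔ θ x ![v] = 0
  nondegenerate : ∀ x ∈ U, ∀ u ∈ D x, (∀ v ∈ D x, extDer θ x ![u, v] = 0) → u = 0

/-- `D` is a contact structure: near each point it is the kernel of a contact form. -/
def IsContactStructure (D : Distribution n M) : Prop :=
  ∀ x : M, ∃ (U : Set M) (θ : DiffForm (2 * n + 1) M 1), x ∈ U ∧ IsContactFormOn D θ U

/-- `E` is a smooth subbundle of rank `r` of the tangent bundle: near each point it has a smooth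
frame with `r` members. -/
def IsSmoothSubbundle (E : Distribution n M) (r : ℕ) : Prop :=
  ∀ x : M, ∃ U : Set M, IsOpen U ∧ x ∈ U ∧
    ∃ X : Fin r → (y : M) → TangentSpace (𝓡 (2 * n + 1)) y,
      (∀ i, SmoothFieldOn (X i) U) ∧
      ∀ y ∈ U, LinearIndependent ℝ (fun i => X i y) ∧
        Submodule.span ℝ (Set.range fun i => X i y) = E y

/-- `E` is a Lagrangian subbundle of the contact structure `D` on the `(2n+1)`-manifold `M`: a
smooth subbundle of rank `n` of `D` that is isotropic for the conformal symplectic structure,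
which is given by `dθ` for the local contact forms `θ`. -/
structure IsLagrangianSubbundle (D E : Distribution n M) : Prop where
  subbundle : IsSmoothSubbundle E n
  le : ∀ x, E x ≤ D x
  isotropic : ∀ (U : Set M) (θ : DiffForm (2 * n + 1) M 1), IsContactFormOn D θ U →
    ∀ x ∈ U, ∀ u ∈ E x, ∀ v ∈ E x, extDer θ x ![u, v] = 0

/-- `(E₁, E₂)` is a Lagrangian pair: two Lagrangian subbundles with `D = E₁ ⊕ E₂`. -/
structure IsLagrangianPair (D E₁ E₂ : Distribution n M) : Prop where
  left : IsLagrangianSubbundle D E₁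
  right : IsLagrangianSubbundle D E₂
  inf_eq : ∀ x, E₁ x ⊓ E₂ x = ⊥
  sup_eq : ∀ x, E₁ x ⊔ E₂ x = D x

/-- `(w₁, w₂)` is a bi-decomposition of the `n`-form `w` for `(E₁, E₂)` on `U`: `w = w₁ - w₂`,
`i_u w₁ = 0` for `u ∈ E₂`, `i_v w₂ = 0` for `v ∈ E₁`, and `w₁`, `w₂` restrict to volume forms of
`E₁`, `E₂`. The equation `i_u w = 0` is stated as: `w` vanishes if some argument is `u`. -/
structure IsBiDecompositionOn (E₁ E₂ : Distribution n M) (w w₁ w₂ : DiffForm (2 * n + 1) M n)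
    (U : Set M) : Prop where
  smooth₁ : SmoothFormOn w₁ U
  smooth₂ : SmoothFormOn w₂ U
  eq_sub : ∀ x ∈ U, w x = w₁ x - w₂ x
  interior₁ : ∀ x ∈ U, ∀ v : Fin n → TangentSpace (𝓡 (2 * n + 1)) x,
    (∃ i, v i ∈ E₂ x) → w₁ x v = 0
  interior₂ : ∀ x ∈ U, ∀ v : Fin n → TangentSpace (𝓡 (2 * n + 1)) x,
    (∃ i, v i ∈ E₁ x) → w₂ x v = 0
  volume₁ : ∀ x ∈ U, ∃ v : Fin n → TangentSpace (𝓡 (2 * n + 1)) x,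
    (∀ i, v i ∈ E₁ x) ∧ w₁ x v ≠ 0
  volume₂ : ∀ x ∈ U, ∃ v : Fin n → TangentSpace (𝓡 (2 * n + 1)) x,
    (∀ i, v i ∈ E₂ x) ∧ w₂ x v ≠ 0

/-- The `n`-form `w` on `M` is bi-decomposable for `(E₁, E₂)`: it is smooth and has a
bi-decomposition near each point. -/
def IsBiDecomposable (E₁ E₂ : Distribution n M) (w : DiffForm (2 * n + 1) M n) : Prop :=
  SmoothFormOn w Set.univ ∧
  ∀ x : M, ∃ U : Set M, IsOpen U ∧ x ∈ U ∧
    ∃ w₁ w₂ : DiffForm (2 * n + 1) M n, IsBiDecompositionOn E₁ E₂ w w₁ w₂ U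

/-- The Monge–Ampère system `⟨θ, dθ, w⟩` on the contact manifold `(M, D)`, as a sheaf of graded
ideals: a smooth `k`-form on the open set `U` belongs to it if near each point of `U` it lies in the
ideal generated by `θ`, `dθ` and `w` for a local contact form `θ`. -/
def mongeAmpereSystem (D : Distribution n M) (w : DiffForm (2 * n + 1) M n) (U : Set M) (k : ℕ) :
    Set (DiffForm (2 * n + 1) M k) :=
  {α | SmoothFormOn α U ∧ ∀ x ∈ U, ∃ (V : Set M) (θ : DiffForm (2 * n + 1) M 1),
    x ∈ V ∧ V ⊆ U ∧ IsContactFormOn D θ V ∧ α ∈ generatedIdeal θ w V k}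

end Contact

end LagrangianContact

end

/-! Since `w'` lies in the system generated by `w`, near each point `w' = θ₀ ∧ α + dθ₀ ∧ β + g w`
for some local contact form `θ₀`; the coefficient `g` of `w` is a smooth function because `w` and
`w'` have the same degree. Both `θ₀` and `dθ₀` vanish on a Lagrangian subbundle, so `w' = g w` on
`E₁` and on `E₂`, with the same `g` (`exists_eqOn_lagrangian`).

A bi-decomposable form on `D = E₁ ⊕ E₂` has no mixed terms: `w (a + b) = w a + w b` for tuples `a`
in `E₁` and `b` in `E₂` (`IsBiDecompositionOn.apply_add`). Hence `w' - g w` vanishes on all of `D =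
ker θ`. For a field `R` with `θ R = 1`, a form vanishing on `ker θ` equals `θ` wedge its contraction
with `R` (`eq_wedge_interior`), which gives `η`. Finally `g` has no zero, since `w'` is nonzero on
`E₁`. -/

noncomputable section

namespace LagrangianContact

/-! ### Pointwise exterior algebra: evaluating wedge products and dividing by a one-form. -/

section Algebra

variable {E : Type*} [AddCommGroup E] [Module ℝ E] [TopologicalSpace E]

/-- The slot of the exterior product `wedge h a b` that corresponds to an index of `a` or `b`. -/
def wedgeSlot {k l m : ℕ} (h : k + l = m) : Fin k ⊕ Fin l ≃ Fin m :=
  finSumFinEquiv.trans (finCongr h)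

theorem wedge_apply {k l m : ℕ} (h : k + l = m) (a : E [⋀^Fin k]→L[ℝ] ℝ)
    (b : E [⋀^Fin l]→L[ℝ] ℝ) (v : Fin m → E) :
    wedge h a b v = ∑ σ : Equiv.Perm.ModSumCongr (Fin k) (Fin l),
      LinearMap.mul' ℝ ℝ (AlternatingMap.domCoprod.summand a.toAlternatingMap b.toAlternatingMap σ
        fun i => v (wedgeSlot h i)) := by
  change (LinearMap.mul' ℝ ℝ) ((a.toAlternatingMap.domCoprod b.toAlternatingMap)
          (fun i => v (wedgeSlot h i))) = _
  simp only [AlternatingMap.domCoprod_apply, _root_.sum_apply, map_sum]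

theorem mul'_summand_mk {k l : ℕ} (a : E [⋀^Fin k]→L[ℝ] ℝ)
    (b : E [⋀^Fin l]→L[ℝ] ℝ) (σ : Equiv.Perm (Fin k ⊕ Fin l)) (v : Fin k ⊕ Fin l → E) :
    LinearMap.mul' ℝ ℝ (AlternatingMap.domCoprod.summand a.toAlternatingMap b.toAlternatingMap
      (Quotient.mk'' σ) v) =
      Equiv.Perm.sign σ • (a (fun i => v (σ (Sum.inl i))) * b (fun i => v (σ (Sum.inr i)))) := by
  simp only [AlternatingMap.domCoprod.summand_mk'', _root_.smul_apply,
    MultilinearMap.domDomCongr_apply, MultilinearMap.domCoprod_apply,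
    map_zsmul_unit, LinearMap.mul'_apply]
  rfl

/-- Every shuffle term has a factor `a` evaluated on a selection of the arguments. This is how
multiples of `θ` and `dθ` die on a Lagrangian subbundle. -/
theorem wedge_eq_zero_of_left {k l m : ℕ} (h : k + l = m) (a : E [⋀^Fin k]→L[ℝ] ℝ)
    (b : E [⋀^Fin l]→L[ℝ] ℝ) (v : Fin m → E) (ha : ∀ f : Fin k → Fin m, a (v ∘ f) = 0) :
    wedge h a b v = 0 := by
  rw [wedge_apply]
  refine Finset.sum_eq_zero fun σ _ => ?_
  induction σ using Quotient.inductionOn' with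
  | h σ =>
    rw [mul'_summand_mk]
    have := ha fun i => wedgeSlot h (σ (Sum.inl i))
    simp only [Function.comp_def] at this
    rw [this, zero_mul, smul_zero]

/-- Shuffles are cosets of the block-preserving permutations; under `hv` only the trivial coset
contributes. -/
theorem wedge_eq_mul {k l m : ℕ} (h : k + l = m) (a : E [⋀^Fin k]→L[ℝ] ℝ)
    (b : E [⋀^Fin l]→L[ℝ] ℝ) (v : Fin m → E)
    (hv : ∀ σ : Equiv.Perm (Fin k ⊕ Fin l), σ ∉ (Equiv.Perm.sumCongrHom (Fin k) (Fin l)).range →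
      a (fun i => v (wedgeSlot h (σ (Sum.inl i)))) *
        b (fun i => v (wedgeSlot h (σ (Sum.inr i)))) = 0) :
    wedge h a b v = a (fun i => v (wedgeSlot h (Sum.inl i))) *
      b (fun i => v (wedgeSlot h (Sum.inr i))) := by
  refine (wedge_apply h a b v).trans ((Finset.sum_eq_single
    (Quotient.mk'' 1 : Equiv.Perm.ModSumCongr (Fin k) (Fin l)) ?_ ?_).trans ?_)
  rotate_right
  · rw [mul'_summand_mk]
    simp
  · intro σ _ hσ
    induction σ using Quotient.inductionOn' with
    | h σ =>
      rw [mul'_summand_mk, hv σ, smul_zero]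
      intro hmem
      refine hσ (Quotient.sound' ?_)
      rw [QuotientGroup.leftRel_apply, mul_one]
      exact inv_mem hmem
  · simp

/-- The exterior product with a function. -/
theorem wedge_zero_right {k m l : ℕ} (h : k + l = m) (hk : k = m) (a : E [⋀^Fin k]→L[ℝ] ℝ)
    (b : E [⋀^Fin l]→L[ℝ] ℝ) (v : Fin m → E) (z : Fin l → E) :
    wedge h a b v = a (fun i => v (Fin.cast hk i)) * b z := by
  subst hk
  obtain rfl : l = 0 := by omega
  rw [wedge_eq_mul]
  · congr 2
    exact Subsingleton.elim _ _
  -- With an empty right block every permutation preserves the left one.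
  · intro σ hσ
    refine absurd (Equiv.Perm.mem_sumCongrHom_range_of_perm_mapsTo_inl ?_) hσ
    rintro _ ⟨i, rfl⟩
    rcases σ (Sum.inl i) with j | j
    · exact ⟨j, rfl⟩
    · exact j.elim0

/-- An alternating form that vanishes as soon as one argument is `R`, or all arguments are in the
hyperplane `ker t`, vanishes if `t R = 1`. -/
theorem alternating_eq_zero {k : ℕ} (γ : E [⋀^Fin k]→L[ℝ] ℝ) (t : E → ℝ) (R : E)
    (S : Set E) (hS : ∀ v, v - t v • R ∈ S)
    (hR : ∀ (v : Fin k → E) (i : Fin k), v i = R → γ v = 0)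
    (hγ : ∀ v : Fin k → E, (∀ i, v i ∈ S) → γ v = 0) : γ = 0 := by
  ext v
  -- Split each argument into its part in `S` and a multiple of `R`, and expand: any term containing
  -- `R` vanishes by `hR`, and the one remaining term by `hγ`.
  have hv : v = (fun i => v i - t (v i) • R) + fun i => t (v i) • R := by
    ext i; simp
  rw [hv]
  change γ.toMultilinearMap _ = 0
  rw [MultilinearMap.map_add_univ]
  refine Finset.sum_eq_zero fun s _ => ?_
  change γ _ = 0
  by_cases hs : ∃ i, i ∉ s
  · obtain ⟨i, hi⟩ := hs
    set u := s.piecewise (fun i => v i - t (v i) • R) fun i => t (v i) • R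
    have hu : u = Function.update u i (t (v i) • R) := by
      rw [eq_comm, Function.update_eq_self_iff]
      simp [u, hi]
    rw [hu, ContinuousAlternatingMap.map_update_smul, hR _ i (by simp), smul_zero]
  · push Not at hs
    refine hγ _ fun i => ?_
    simp [hs i, hS]

/-- A multilinear form that vanishes as soon as one argument is in `S`, is unchanged if
arguments in `S` are added. -/
theorem map_add_of_vanish {k : ℕ} (γ : E [⋀^Fin k]→L[ℝ] ℝ) (S : Set E)
    (hS : ∀ v : Fin k → E, (∃ i, v i ∈ S) → γ v = 0) (a b : Fin k → E) (hb : ∀ i, b i ∈ S) :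
    γ (a + b) = γ a := by
  change γ.toMultilinearMap _ = _
  rw [MultilinearMap.map_add_univ, Finset.sum_eq_single Finset.univ]
  · simp
  · intro s _ hs
    obtain ⟨i, hi⟩ : ∃ i, i ∉ s := by
      by_contra! h
      exact hs (Finset.eq_univ_of_forall h)
    exact hS _ ⟨i, by simpa [hi] using hb i⟩
  · simp

/-- If `θ R = 1` and the form `β` vanishes on the kernel of `θ`, then `β = θ ∧ i_R β`. -/
theorem eq_wedge_interior {k m : ℕ} (h : 1 + k = m) (hm : k + 1 = m)
    (θ : E [⋀^Fin 1]→L[ℝ] ℝ) (R : E)   (hR : θ ![R] = 1) (β : E [⋀^Fin m]→L[ℝ] ℝ) (η : E [⋀^Fin k]→L[ℝ] ℝ)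
    (hη : ∀ v : Fin k → E, η v =
      β (fun i => (Fin.cons R v : Fin (k + 1) → E) (Fin.cast hm.symm i)))
    (hβ : ∀ v : Fin m → E, (∀ i, θ ![v i] = 0) → β v = 0) :
    β = wedge h θ η := by
  subst hm
  have hθ (f : Fin 1 → E) : θ f = θ ![f 0] := by
    congr 1; ext i; fin_cases i; rfl
  have hsub (v : E) : θ ![v - θ ![v] • R] = 0 := by
    have h1 := θ.map_update_add ![R] 0 (v - θ ![v] • R) (θ ![v] • R)
    have h2 := θ.map_update_smul ![R] 0 (θ ![v]) R
    have hup (w : E) : Function.update ![R] (0 : Fin 1) w = ![w] := by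
      ext i; fin_cases i; rfl
    simp only [hup] at h1 h2
    rw [h2, hR] at h1
    simpa using h1.symm
  rw [← sub_eq_zero]
  refine alternating_eq_zero _ (fun v => θ ![v]) R {v | θ ![v] = 0} hsub ?_ ?_
  · have key (v : Fin (k + 1) → E) (hv : v 0 = R) : (β - wedge h θ η) v = 0 := by
      have hslot : wedgeSlot h (Sum.inl 0) = 0 := by
        ext; simp [wedgeSlot]
      have hslot' (i : Fin k) : wedgeSlot h (Sum.inr i) = i.succ := by
        ext; simp [wedgeSlot]
      rw [ContinuousAlternatingMap.sub_apply, sub_eq_zero, wedge_eq_mul, hθ, hslot, hv, hR, one_mul, hη]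
      · congr 1
        ext1 i
        refine Fin.cases ?_ (fun j => ?_) i
        · simpa using hv
        · simp [hslot']
      · intro σ hσ
        suffices hz : η (fun i => v (wedgeSlot h (σ (Sum.inr i)))) = 0 by rw [hz, mul_zero]
        -- The left block is a single slot, so a permutation that does not preserve it hands slot
        -- `0`, which holds `R`, to `η`; then `β` sees `R` twice.
        obtain ⟨j, hj⟩ : ∃ j, σ (Sum.inr j) = Sum.inl 0 := by
          rcases hs : σ.symm (Sum.inl 0) with j | j
          · refine absurd (Equiv.Perm.mem_sumCongrHom_range_of_perm_mapsTo_inl ?_) hσ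
            rintro _ ⟨i, rfl⟩
            rw [Subsingleton.elim i j, ← hs]
            simp
          · exact ⟨j, by rw [← hs]; simp⟩
        rw [hη]
        refine β.map_eq_zero_of_eq _ (i := 0) (j := j.succ) ?_ (Fin.succ_ne_zero j).symm
        simp [hj, hslot, hv]
    -- A transposition moves `R` to slot `0` and only changes the sign.
    intro v i hv
    by_cases hi : i = 0
    · exact key v (hi ▸ hv)
    · have := (β - wedge h θ η).toAlternatingMap.map_swap v hi
      have h2 : (β - wedge h θ η) (v ∘ Equiv.swap i 0) = 0 := key _ (by simpa using hv)
      have h3 : (β - wedge h θ η) (v ∘ Equiv.swap i 0) = - (β - wedge h θ η) v := this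
      rw [h2] at h3
      linarith
  · intro v hv
    have hv' : ∀ i, θ ![v i] = 0 := hv
    rw [ContinuousAlternatingMap.sub_apply, hβ v hv', wedge_eq_zero_of_left, sub_zero]
    intro f
    rw [hθ]
    exact hv' _

end Algebra

/-! ### Smooth forms and fields in local trivializations. -/

section Smooth

variable {d : ℕ} {M : Type*} [TopologicalSpace M] [ChartedSpace (EuclideanSpace ℝ (Fin d)) M]
  [IsManifold (𝓡 d) ∞ M]

variable (d) in
/-- The inverse of the trivialization of the tangent bundle at `x₀`, on the fibre over `y`. -/
def frameAt (x₀ y : M) : EuclideanSpace ℝ (Fin d) →L[ℝ] TangentSpace (𝓡 d) y :=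
  haveI : IsManifold (𝓡 d) 1 M := IsManifold.of_le (n := ∞) (by simp)
  (trivializationAt (EuclideanSpace ℝ (Fin d)) (TangentSpace (𝓡 d) : M → Type _) x₀).symmL ℝ y

/-- The coordinate expression of a form in the trivialization of the tangent bundle at `x₀`. -/
def formCoord {k : ℕ} (α : DiffForm d M k) (x₀ y : M) : EuclideanSpace ℝ (Fin d) [⋀^Fin k]→L[ℝ] ℝ :=
  (α y).compContinuousLinearMap (frameAt d x₀ y)

/-- The coordinate expression of a field in the trivialization of the tangent bundle at `x₀`. -/
def fieldCoord (X : (x : M) → TangentSpace (𝓡 d) x) (x₀ y : M) : EuclideanSpace ℝ (Fin d) :=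
  haveI : IsManifold (𝓡 d) 1 M := IsManifold.of_le (n := ∞) (by simp)
  (trivializationAt (EuclideanSpace ℝ (Fin d)) (TangentSpace (𝓡 d) : M → Type _) x₀ ⟨y, X y⟩).2

/-- Reduces smoothness of a section to that of a map into a fixed normed space, where operations on
forms are smooth maps. -/
theorem smoothFormOn_iff {k : ℕ} {α : DiffForm d M k} {U : Set M} :
    SmoothFormOn α U ↔ ∀ x ∈ U, ContMDiffWithinAt (𝓡 d)
      𝓘(ℝ, EuclideanSpace ℝ (Fin d) [⋀^Fin k]→L[ℝ] ℝ) ∞ (formCoord α x) U x := by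
  have : IsManifold (𝓡 d) 1 M := IsManifold.of_le (n := ∞) (by simp)
  refine forall₂_congr fun x _ => ?_
  rw [Bundle.contMDiffWithinAt_section]
  refine iff_of_eq ?_
  congr 1
  ext1 y
  rw [FiberBundle.trivializationAt_continuousAlternatingMap_apply]
  ext v
  simp [ContinuousAlternatingMap.inCoordinates, formCoord, frameAt]

theorem smoothFieldOn_iff {X : (x : M) → TangentSpace (𝓡 d) x} {U : Set M} :
    SmoothFieldOn X U ↔ ∀ x ∈ U, ContMDiffWithinAt (𝓡 d)
      𝓘(ℝ, EuclideanSpace ℝ (Fin d)) ∞ (fieldCoord X x) U x := by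
  have : IsManifold (𝓡 d) 1 M := IsManifold.of_le (n := ∞) (by simp)
  refine forall₂_congr fun x _ => ?_
  rw [Bundle.contMDiffWithinAt_section]
  rfl

theorem SmoothFormOn.mono {k : ℕ} {α : DiffForm d M k} {U V : Set M} (h : SmoothFormOn α U)
    (hV : V ⊆ U) : SmoothFormOn α V :=
  ContMDiffOn.mono h hV

theorem frameAt_fieldCoord (X : (x : M) → TangentSpace (𝓡 d) x) (x₀ y : M)
    (hy : y ∈ (chartAt (EuclideanSpace ℝ (Fin d)) x₀).source) :
    frameAt d x₀ y (fieldCoord X x₀ y) = X y := by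
  have : IsManifold (𝓡 d) 1 M := IsManifold.of_le (n := ∞) (by simp)
  rw [frameAt, fieldCoord]
  have hy' : y ∈ (trivializationAt (EuclideanSpace ℝ (Fin d))
    (TangentSpace (𝓡 d) : M → Type _) x₀).baseSet := hy
  rw [Bundle.Trivialization.symmL_apply]
  · exact Bundle.Trivialization.symm_apply_apply_mk _ hy' _
  · exact hy'

/-- The interior product of a form with a vector field. -/
def interior {k : ℕ} (X : (x : M) → TangentSpace (𝓡 d) x) (α : DiffForm d M (k + 1)) :
    DiffForm d M k := fun y =>
  ContinuousAlternatingMap.curryLeft (E := EuclideanSpace ℝ (Fin d)) (α y) (X y)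

omit [IsManifold (𝓡 d) ∞ M] in
theorem interior_apply {k : ℕ} (X : (x : M) → TangentSpace (𝓡 d) x) (α : DiffForm d M (k + 1))
    (y : M) (v : Fin k → TangentSpace (𝓡 d) y) :
    interior X α y v = α y (Fin.cons (X y) v : Fin (k + 1) → TangentSpace (𝓡 d) y) :=
  rfl

/-- In a trivialization contraction is currying, a bounded linear map, followed by evaluation at the
coordinates of the field. -/
theorem SmoothFormOn.interior {k : ℕ} {X : (x : M) → TangentSpace (𝓡 d) x}
    {α : DiffForm d M (k + 1)} {U : Set M} (hα : SmoothFormOn α U) (hX : SmoothFieldOn X U) :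
    SmoothFormOn (interior X α) U := by
  rw [smoothFormOn_iff] at *
  rw [smoothFieldOn_iff] at hX
  intro x hx
  have hc : ContDiff ℝ ∞ fun β : EuclideanSpace ℝ (Fin d) [⋀^Fin (k + 1)]→L[ℝ] ℝ => β.curryLeft :=
    IsBoundedLinearMap.contDiff (f := fun β : EuclideanSpace ℝ (Fin d) [⋀^Fin (k + 1)]→L[ℝ] ℝ =>
      β.curryLeft) ⟨⟨fun _ _ => rfl, fun _ _ => rfl⟩, 1, one_pos,
        fun β => by rw [one_mul, ContinuousAlternatingMap.norm_curryLeft]⟩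
  have h1 := hc.contMDiff.contMDiffAt.comp_contMDiffWithinAt x (hα x hx)
  have h2 := h1.clm_apply (hX x hx)
  have heq : ∀ y ∈ (chartAt (EuclideanSpace ℝ (Fin d)) x).source,
      formCoord (LagrangianContact.interior X α) x y =
        (formCoord α x y).curryLeft (fieldCoord X x y) := by
    intro y hy
    ext v
    simp only [formCoord, ContinuousAlternatingMap.compContinuousLinearMap_apply, interior_apply,
      ContinuousAlternatingMap.curryLeft_apply_apply]
    congr 1
    ext1 i
    refine Fin.cases ?_ (fun i => ?_) i
    · exact (frameAt_fieldCoord X x y hy).symm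
    · rfl
  refine h2.congr_of_eventuallyEq ?_ (heq x (mem_chart_source _ x))
  exact Filter.eventually_of_mem (mem_nhdsWithin_of_mem_nhds
    ((chartAt _ x).open_source.mem_nhds (mem_chart_source _ x))) heq

theorem SmoothFormOn.sub_smul {k : ℕ} {α β : DiffForm d M k} {f : M → ℝ} {U : Set M}
    (hα : SmoothFormOn α U) (hf : ContMDiffOn (𝓡 d) 𝓘(ℝ, ℝ) ∞ f U) (hβ : SmoothFormOn β U) :
    SmoothFormOn (fun y => α y - f y • β y) U := by
  rw [smoothFormOn_iff] at *
  intro x hx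
  exact (hα x hx).sub ((hf x hx).smul (hβ x hx))

/-- The function that is the value of a form of degree zero. -/
theorem SmoothFormOn.contMDiffOn_apply_zero {l : ℕ} (hl : l = 0) {a : DiffForm d M l} {U : Set M}
    (ha : SmoothFormOn a U) :
    ContMDiffOn (𝓡 d) 𝓘(ℝ, ℝ) ∞ (fun y => a y 0) U := by
  subst hl
  rw [smoothFormOn_iff] at ha
  intro x hx
  have := ((ContinuousAlternatingMap.apply ℝ (EuclideanSpace ℝ (Fin d)) ℝ
    (0 : Fin 0 → _)).contMDiff (n := ∞) _).comp_contMDiffWithinAt x (ha x hx)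
  refine this.congr (fun y _ => ?_) ?_ <;>
  · exact congrArg _ (Subsingleton.elim _ _)

theorem smoothFormOn_constOfIsEmpty (U : Set M) :
    SmoothFormOn (fun _ => ContinuousAlternatingMap.constOfIsEmpty ℝ _ (Fin 0) (1 : ℝ) :
      DiffForm d M 0) U := by
  rw [smoothFormOn_iff]
  intro x hx
  exact contMDiffWithinAt_const (c := ContinuousAlternatingMap.constOfIsEmpty ℝ _ (Fin 0) (1 : ℝ))

theorem contMDiffOn_apply_field {θ : DiffForm d M 1} {X : (x : M) → TangentSpace (𝓡 d) x}
    {U : Set M} (hθ : SmoothFormOn θ U) (hX : SmoothFieldOn X U) :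
    ContMDiffOn (𝓡 d) 𝓘(ℝ, ℝ) ∞ (fun y => θ y ![X y]) U := by
  refine (((hθ.interior hX).contMDiffOn_apply_zero rfl).congr fun y _ => ?_)
  rw [interior_apply]
  congr 1
  ext1 i
  fin_cases i
  rfl

theorem SmoothFieldOn.smul {X : (x : M) → TangentSpace (𝓡 d) x} {f : M → ℝ}
    {U : Set M} (hf : ContMDiffOn (𝓡 d) 𝓘(ℝ, ℝ) ∞ f U) (hX : SmoothFieldOn X U) :
    SmoothFieldOn (fun y => f y • X y) U := by
  have : IsManifold (𝓡 d) 1 M := IsManifold.of_le (n := ∞) (by simp)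
  exact ContMDiffOn.smul_section hf hX

theorem exists_smoothFieldOn (x : M) (v : TangentSpace (𝓡 d) x) :
    ∃ (U : Set M) (X : (x : M) → TangentSpace (𝓡 d) x), IsOpen U ∧ x ∈ U ∧ SmoothFieldOn X U ∧
      X x = v := by
  have : IsManifold (𝓡 d) 1 M := IsManifold.of_le (n := ∞) (by simp)
  obtain ⟨s, hs, h⟩ := FiberBundle.exists_contMDiffOn_extend (I := 𝓡 d) (k := ∞)
    (EuclideanSpace ℝ (Fin d)) (V := (TangentSpace (𝓡 d) : M → Type _)) v
  obtain ⟨U, hU, hUo, hx⟩ := mem_nhds_iff.1 hs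
  exact ⟨U, _, hUo, hx, ContMDiffOn.mono h hU, by simp⟩

/-- Near each point a smooth nowhere vanishing one-form has a smooth field on which it is one. -/
theorem exists_field_apply_eq_one {θ : DiffForm d M 1} {U : Set M} (hU : IsOpen U)
    (hθ : SmoothFormOn θ U) {x : M} (hx : x ∈ U) (hne : θ x ≠ 0) :
    ∃ (V : Set M) (R : (x : M) → TangentSpace (𝓡 d) x), IsOpen V ∧ x ∈ V ∧ V ⊆ U ∧
      SmoothFieldOn R V ∧ ∀ y ∈ V, θ y ![R y] = 1 := by
  obtain ⟨v, hv⟩ : ∃ v, θ x ![v] ≠ 0 := by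
    by_contra! h
    refine hne (ContinuousAlternatingMap.ext fun f => ?_)
    refine Eq.trans ?_ (h (f 0))
    congr 1
    ext1 i
    fin_cases i
    rfl
  obtain ⟨W, X, hW, hxW, hX, rfl⟩ := exists_smoothFieldOn x v
  have hs := contMDiffOn_apply_field (hθ.mono (inter_subset_left (t := W)))
    (ContMDiffOn.mono hX (inter_subset_right (s := U)))
  -- Shrink to the open set where `θ X ≠ 0` and normalize: `R = X / θ X`.
  refine ⟨(U ∩ W) ∩ (fun y => θ y ![X y]) ⁻¹' {0}ᶜ, fun y => (θ y ![X y])⁻¹ • X y,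
    hs.continuousOn.isOpen_inter_preimage (hU.inter hW) isOpen_compl_singleton,
    ⟨⟨hx, hxW⟩, hv⟩, fun y hy => hy.1.1, ?_, ?_⟩
  · refine SmoothFieldOn.smul ?_ (ContMDiffOn.mono hX fun y hy => hy.1.2)
    exact (hs.mono inter_subset_left).inv₀ fun y hy => hy.2
  · intro y hy
    have h := (θ y).map_update_smul ![X y] 0 (θ y ![X y])⁻¹ (X y)
    have hup (w : TangentSpace (𝓡 d) y) : Function.update ![X y] (0 : Fin 1) w = ![w] := by
      ext1 i; fin_cases i; rfl
    simp only [hup] at h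
    rw [h, smul_eq_mul, inv_mul_cancel₀ hy.2]

end Smooth

/-! ### Monge–Ampère systems and bi-decomposable forms on the Lagrangian subbundles. -/

section Contact

variable {n : ℕ} {M : Type*} [TopologicalSpace M]
  [ChartedSpace (EuclideanSpace ℝ (Fin (2 * n + 1))) M] [IsManifold (𝓡 (2 * n + 1)) ∞ M]

theorem IsContactFormOn.apply_eq_zero {D : Distribution n M} {θ : DiffForm (2 * n + 1) M 1}
    {U : Set M} (hθ : IsContactFormOn D θ U) {y : M} (hy : y ∈ U)
    (f : Fin 1 → TangentSpace (𝓡 (2 * n + 1)) y) (hf : f 0 ∈ D y) : θ y f = 0 := by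
  rw [← (hθ.mem_iff y hy _).1 hf]
  congr 1
  ext1 i
  fin_cases i
  rfl

theorem IsLagrangianSubbundle.extDer_apply_eq_zero {D E : Distribution n M}
    (hE : IsLagrangianSubbundle D E) {θ : DiffForm (2 * n + 1) M 1}
    {U : Set M} (hθ : IsContactFormOn D θ U) {y : M} (hy : y ∈ U)
    (f : Fin 2 → TangentSpace (𝓡 (2 * n + 1)) y) (hf : ∀ i, f i ∈ E y) : extDer θ y f = 0 := by
  rw [← hE.isotropic U θ hθ y hy _ (hf 0) _ (hf 1)]
  congr 1
  ext1 i
  fin_cases i <;> rfl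

theorem IsMultipleOn.apply_eq_zero {U : Set M} {p k : ℕ} {β : DiffForm (2 * n + 1) M p}
    {α : DiffForm (2 * n + 1) M k} (h : IsMultipleOn U β α) {y : M} (hy : y ∈ U)
    (v : Fin k → TangentSpace (𝓡 (2 * n + 1)) y) (hv : ∀ f : Fin p → Fin k, β y (v ∘ f) = 0) :
    α y v = 0 := by
  rcases h with ⟨l, h, a, -, heq⟩ | h
  · rw [heq y hy]
    exact wedge_eq_zero_of_left _ _ _ _ hv
  · rw [h y hy]
    rfl

/-- A multiple of a form, of the same degree, is the product with a smooth function. -/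
theorem IsMultipleOn.exists_smul {U : Set M} {k : ℕ} {β α : DiffForm (2 * n + 1) M k}
    (h : IsMultipleOn U β α) :
    ∃ g : M → ℝ, ContMDiffOn (𝓡 (2 * n + 1)) 𝓘(ℝ, ℝ) ∞ g U ∧ ∀ y ∈ U, α y = g y • β y := by
  rcases h with ⟨l, h, a, ha, heq⟩ | h
  · refine ⟨_, ha.contMDiffOn_apply_zero (by omega), fun y hy => ?_⟩
    rw [heq y hy]
    ext v
    rw [wedge_zero_right h rfl _ _ _ 0, mul_comm]
    rfl
  · exact ⟨fun _ => 0, contMDiffOn_const, fun y hy => by rw [h y hy, zero_smul]⟩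

/-- The form `w` belongs to the Monge–Ampère system that it generates. -/
theorem mem_mongeAmpereSystem_self {D : Distribution n M} (hD : IsContactStructure D)
    {w : DiffForm (2 * n + 1) M n} (hw : SmoothFormOn w univ) :
    w ∈ mongeAmpereSystem D w univ n := by
  refine ⟨hw, fun x _ => ?_⟩
  obtain ⟨V, θ, hx, hθ⟩ := hD x
  -- The coefficient of `w` is the constant function `1`, as a zero-form.
  refine ⟨V, θ, hx, subset_univ V, hθ, 0, 0, w, Or.inr fun _ _ => rfl, Or.inr fun _ _ => rfl,
    Or.inl ⟨0, add_zero n, _, smoothFormOn_constOfIsEmpty V, fun y _ => ?_⟩, fun y _ => ?_⟩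
  · ext v
    rw [wedge_zero_right _ rfl _ _ _ 0]
    exact (mul_one _).symm
  · simp

/-- Near each point a form of degree `n` in the Monge–Ampère system `⟨θ, dθ, w⟩` is, on the
Lagrangian subbundles, a multiple of `w`. -/
theorem exists_eqOn_lagrangian {D : Distribution n M} {w w' : DiffForm (2 * n + 1) M n}
    (h : w' ∈ mongeAmpereSystem D w univ n) (x : M) :
    ∃ (V : Set M) (g : M → ℝ), IsOpen V ∧ x ∈ V ∧
      ContMDiffOn (𝓡 (2 * n + 1)) 𝓘(ℝ, ℝ) ∞ g V ∧
      ∀ E : Distribution n M, IsLagrangianSubbundle D E → ∀ y ∈ V,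
        ∀ v : Fin n → TangentSpace (𝓡 (2 * n + 1)) y, (∀ i, v i ∈ E y) →
          w' y v = g y * w y v := by
  obtain ⟨V, θ, hx, -, hθ, α₁, α₂, α₃, h₁, h₂, h₃, heq⟩ := h.2 x (mem_univ x)
  obtain ⟨g, hg, h₃⟩ := h₃.exists_smul
  -- `g` is chosen before `E`, so one function serves both subbundles. Isotropy holds for every
  -- local contact form, so it does not matter which one the system supplies.
  refine ⟨V, g, hθ.isOpen, hx, hg, fun E hE y hy v hv => ?_⟩
  rw [heq y hy, h₃ y hy]
  have h1 : α₁ y v = 0 := h₁.apply_eq_zero hy v fun f =>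
    hθ.apply_eq_zero hy _ (hE.le y (hv _))
  have h2 : α₂ y v = 0 := h₂.apply_eq_zero hy v fun f =>
    hE.extDer_apply_eq_zero hθ hy _ fun i => hv _
  change α₁ y v + α₂ y v + g y * w y v = _
  rw [h1, h2]
  ring

/-- A bi-decomposable form splits on the contact distribution. -/
theorem IsBiDecompositionOn.apply_add {E₁ E₂ : Distribution n M}
    {w w₁ w₂ : DiffForm (2 * n + 1) M n} {U : Set M} (h : IsBiDecompositionOn E₁ E₂ w w₁ w₂ U)
    (hn : 1 ≤ n) {y : M} (hy : y ∈ U) (a b : Fin n → TangentSpace (𝓡 (2 * n + 1)) y)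
    (ha : ∀ i, a i ∈ E₁ y) (hb : ∀ i, b i ∈ E₂ y) : w y (a + b) = w y a + w y b := by
  have e1 : w₁ y (a + b) = w₁ y a :=
    map_add_of_vanish (w₁ y) (E₂ y) (h.interior₁ y hy) a b hb
  have e2 : w₂ y (a + b) = w₂ y b := by
    rw [add_comm a b]
    exact map_add_of_vanish (w₂ y) (E₁ y) (h.interior₂ y hy) b a ha
  -- Here `1 ≤ n` matters: an argument is needed for the form to be killed by it.
  have e3 : w₁ y b = 0 := h.interior₁ y hy b ⟨⟨0, hn⟩, hb _⟩
  have e4 : w₂ y a = 0 := h.interior₂ y hy a ⟨⟨0, hn⟩, ha _⟩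
  rw [h.eq_sub y hy]
  change w₁ y (a + b) - w₂ y (a + b) = (w₁ y a - w₂ y a) + (w₁ y b - w₂ y b)
  rw [e1, e2, e3, e4]
  ring

theorem IsBiDecompositionOn.exists_apply_ne_zero {E₁ E₂ : Distribution n M}
    {w w₁ w₂ : DiffForm (2 * n + 1) M n} {U : Set M} (h : IsBiDecompositionOn E₁ E₂ w w₁ w₂ U)
    (hn : 1 ≤ n) {y : M} (hy : y ∈ U) :
    ∃ a : Fin n → TangentSpace (𝓡 (2 * n + 1)) y, (∀ i, a i ∈ E₁ y) ∧ w y a ≠ 0 := by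
  obtain ⟨a, ha, hne⟩ := h.volume₁ y hy
  have e : w₂ y a = 0 := h.interior₂ y hy a ⟨⟨0, hn⟩, ha _⟩
  refine ⟨a, ha, ?_⟩
  rw [h.eq_sub y hy]
  change w₁ y a - w₂ y a ≠ 0
  rwa [e, sub_zero]

end Contact

end LagrangianContact

end

/-! ### The theorem. -/

theorem theorem3p1 {n : ℕ} (hn : 1 ≤ n) {M : Type*} [TopologicalSpace M]
    [ChartedSpace (EuclideanSpace ℝ (Fin (2 * n + 1))) M] [IsManifold (𝓡 (2 * n + 1)) ∞ M]
    (D E₁ E₂ : LagrangianContact.Distribution n M)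
    (hD : LagrangianContact.IsContactStructure D)
    (hE : LagrangianContact.IsLagrangianPair D E₁ E₂)
    (w w' : LagrangianContact.DiffForm (2 * n + 1) M n)
    (hw : LagrangianContact.IsBiDecomposable E₁ E₂ w)
    (hw' : LagrangianContact.IsBiDecomposable E₁ E₂ w')
    (hsys : ∀ U : Set M, IsOpen U → ∀ k : ℕ,
      LagrangianContact.mongeAmpereSystem D w U k =
        LagrangianContact.mongeAmpereSystem D w' U k)
    (U : Set M) (θ : LagrangianContact.DiffForm (2 * n + 1) M 1)
    (hθ : LagrangianContact.IsContactFormOn D θ U) (x : M) (hx : x ∈ U) :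
    ∃ V : Set M, IsOpen V ∧ x ∈ V ∧ V ⊆ U ∧
      ∃ (μ : M → ℝ) (η : LagrangianContact.DiffForm (2 * n + 1) M (n - 1)),
        ContMDiffOn (𝓡 (2 * n + 1)) 𝓘(ℝ, ℝ) ∞ μ V ∧
        LagrangianContact.SmoothFormOn η V ∧
        (∀ y ∈ V, μ y ≠ 0) ∧
        ∀ y ∈ V, w' y =
          μ y • w y + LagrangianContact.wedge (Nat.add_sub_cancel' hn) (θ y) (η y) := by
  obtain ⟨m, rfl⟩ : ∃ m, n = m + 1 := ⟨n - 1, by omega⟩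
  have hmem : w' ∈ LagrangianContact.mongeAmpereSystem D w univ (m + 1) := by
    rw [hsys univ isOpen_univ]
    exact LagrangianContact.mem_mongeAmpereSystem_self hD hw'.1
  obtain ⟨V, g, hV, hxV, hg, hgE⟩ := LagrangianContact.exists_eqOn_lagrangian hmem x
  obtain ⟨W, hW, hxW, w₁, w₂, hdec⟩ := hw.2 x
  obtain ⟨W', hW', hxW', w₁', w₂', hdec'⟩ := hw'.2 x
  obtain ⟨O, R, hO, hxO, hOU, hR, hθR⟩ :=
    LagrangianContact.exists_field_apply_eq_one hθ.isOpen hθ.smooth hx (hθ.ne_zero x hx)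
  -- The witnesses are `μ = g` and `η = i_R (w' - g w)`.
  refine ⟨V ∩ W ∩ W' ∩ O, ((hV.inter hW).inter hW').inter hO, ⟨⟨⟨hxV, hxW⟩, hxW'⟩, hxO⟩,
    fun y hy => hOU hy.2, g, LagrangianContact.interior R fun y => w' y - g y • w y,
    hg.mono fun y hy => hy.1.1.1, ?_, ?_, ?_⟩
  · exact LagrangianContact.SmoothFormOn.interior
      ((hw'.1.mono (subset_univ _)).sub_smul (hg.mono fun y hy => hy.1.1.1)
        (hw.1.mono (subset_univ _))) (ContMDiffOn.mono hR fun y hy => hy.2)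
  · rintro y ⟨⟨⟨hyV, -⟩, hyW'⟩, -⟩ h0
    obtain ⟨a, ha, hne⟩ := hdec'.exists_apply_ne_zero hn hyW'
    exact hne (by rw [hgE E₁ hE.left y hyV a ha, h0, zero_mul])
  · rintro y ⟨⟨⟨hyV, hyW⟩, hyW'⟩, hyO⟩
    rw [← sub_eq_iff_eq_add']
    refine LagrangianContact.eq_wedge_interior _ rfl (θ y) (R y) (hθR y hyO) _ _
      (fun v => rfl) fun v hv => ?_
    -- The arguments lie in `ker θ = D = E₁ ⊕ E₂`; split them and compare `w'` with `g w` on each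
    -- summand.
    have hsplit (i : Fin (m + 1)) : ∃ a ∈ E₁ y, ∃ b ∈ E₂ y, a + b = v i := by
      rw [← Submodule.mem_sup, hE.sup_eq]
      exact (hθ.mem_iff y (hOU hyO) _).2 (hv i)
    choose a ha b hb hab using hsplit
    obtain rfl : a + b = v := funext hab
    change w' y (a + b) - g y * w y (a + b) = 0
    rw [hdec.apply_add hn hyW a b ha hb, hdec'.apply_add hn hyW' a b ha hb,
      hgE E₁ hE.left y hyV a ha, hgE E₂ hE.right y hyV b hb]
    ring
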